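/- Let $p_m$ denote the $m$-th prime number ($p_1=2$), and for integers $n,k\ge 1$ define $p_n^{(k)}$ recursively by $p_n^{(1)}=p_n$ and $p_n^{(k)}=p_{p_n^{(k-1)}}$ for $k\ge 2$. Let $\log$ be the natural logarithm. Then for every integer $n\ge 9$ and every integer $k\ge 1$, $$p_n^{(k)} < 2^{2k-1}\cdot n\cdot (k-1)!\cdot\big(\log \max\{k,n\}\big)^{k}.$$ In particular, for all integers $n\ge 9$ and $k\ge n$, $$p_n^{(k)} < (4k\log k)^{k}.$$ -/

import Mathlib

/-- The `n`-th prime number `p_n`, with the indexing from one: `p_1 = 2`, `p_2 = 3`, ...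
(Mathlib's `Nat.nth` counts from zero; the value at `n = 0` is irrelevant.) -/
noncomputable def nthPrime (n : ℕ) : ℕ :=
  Nat.nth Nat.Prime (n - 1)

/-- The iterated prime `p_n^{(k)}`: `p_n^{(1)} = p_n` and `p_n^{(k)} = p_{p_n^{(k-1)}}` for `k ≥ 2`.
The recursion is started at the conventional value `p_n^{(0)} = n`. -/
noncomputable def iterPrime (n : ℕ) : ℕ → ℕ
  | 0 => n
  | k + 1 => nthPrime (iterPrime n k)

theorem iterPrime_one (n : ℕ) : iterPrime n 1 = nthPrime n := rfl

theorem iterPrime_succ (n k : ℕ) : iterPrime n (k + 1) = nthPrime (iterPrime n k) := rfl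

/-! The engine is `nthPrime_lt`: p_m < 2m log m for m ≥ 9. Applied to m = p_n^{(k)}, it costs a
factor 2 log m. The inductive bound itself gives m ≤ M^{2k} with M = max(k, n) (`bound_le_pow`), so
this factor is at most 4k log M, and the factors multiply to the claim. For m ≥ 1024 the engine is
Chebyshev's lower bound for ψ; below that, sieved prime counts at a few checkpoints suffice. -/

/-- The number of integers in `[a, a + 2 ^ d)` that are coprime to `P`, by bisection. -/
def coprimeCount (P : ℕ) : ℕ → ℕ → ℕ
  | 0, a => if Nat.gcd a P = 1 then 1 else 0
  | d + 1, a => coprimeCount P d a + coprimeCount P d (a + 2 ^ d)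

theorem prime_of_gcd_eq_one {P B m : ℕ} (hP : ∀ q, q.Prime → q * q < B → q ∣ P)
    (hm : 2 ≤ m) (hmB : m < B) (hgcd : Nat.gcd m P = 1) : m.Prime := by
  by_contra h
  have hq : m.minFac.Prime := Nat.minFac_prime (by omega)
  have hsq : m.minFac * m.minFac ≤ m := by
    simpa [sq] using Nat.minFac_sq_le_self (by omega) h
  have hdvd := Nat.dvd_gcd (Nat.minFac_dvd m) (hP _ hq (by omega))
  rw [hgcd] at hdvd
  exact hq.one_lt.ne' (Nat.dvd_one.mp hdvd)

theorem primeCounting'_add_coprimeCount_le {P B : ℕ}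
    (hP : ∀ q, q.Prime → q * q < B → q ∣ P) (d a : ℕ) (ha : 2 ≤ a) (hB : a + 2 ^ d ≤ B) :
    Nat.primeCounting' a + coprimeCount P d a ≤ Nat.primeCounting' (a + 2 ^ d) := by
  induction d generalizing a with
  | zero =>
    simp only [pow_zero] at hB ⊢
    rw [Nat.primeCounting', Nat.count_succ, coprimeCount]
    by_cases h : Nat.gcd a P = 1
    · simp [h, prime_of_gcd_eq_one hP ha (by omega) h]
    · simp [h]
  | succ d ih =>
    rw [pow_succ] at hB ⊢
    have h1 := ih a ha (by omega)
    have h2 := ih (a + 2 ^ d) (by omega) (by omega)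
    rw [coprimeCount]
    rw [show a + 2 ^ d * 2 = a + 2 ^ d + 2 ^ d by ring]
    omega

theorem add_le_primeCounting'_of_le_coprimeCount {P B c k : ℕ}
    (hP : ∀ q, q.Prime → q * q < B → q ∣ P) (d a : ℕ) (ha : 2 ≤ a) (hB : a + 2 ^ d ≤ B)
    (hc : c ≤ Nat.primeCounting' a) (hk : k ≤ coprimeCount P d a) :
    c + k ≤ Nat.primeCounting' (a + 2 ^ d) :=
  (add_le_add hc hk).trans (primeCounting'_add_coprimeCount_le hP d a ha hB)

/-- The product of the primes up to `89`. -/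
def primorialEightyNine : ℕ :=
  2 * 3 * 5 * 7 * 11 * 13 * 17 * 19 * 23 * 29 * 31 * 37 * 41 * 43 * 47 * 53 * 59 * 61 * 67 * 71 *
    73 * 79 * 83 * 89

/-- Here 121 = 11², with 11 the first prime not dividing 210; below, 9409 = 97² likewise. -/
theorem prime_dvd_210 : ∀ q : ℕ, q.Prime → q * q < 121 → q ∣ 210 := by
  intro q hq h
  have : q < 11 := by nlinarith
  interval_cases q <;> first | decide | (exfalso; revert hq; decide)

theorem prime_dvd_primorialEightyNine :
    ∀ q : ℕ, q.Prime → q * q < 9409 → q ∣ primorialEightyNine := by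
  intro q hq h
  have : q < 97 := by nlinarith
  interval_cases q <;> first | decide +kernel | (exfalso; revert hq; norm_num)

theorem natCast_le_log_of_pow_le {s a : ℕ} (h : (2.7182818286 : ℝ) ^ s ≤ a) :
    (s : ℝ) ≤ Real.log a := by
  have h1 : Real.exp s ≤ a := by
    rw [← Real.exp_one_pow]
    exact (pow_le_pow_left₀ (Real.exp_pos 1).le Real.exp_one_lt_d9.le s).trans h
  rwa [Real.le_log_iff_exp_le ((Real.exp_pos _).trans_le h1)]

/-- As log 19 < 3, an integer bound would be 2, and 2·19·2 = 76 misses the checkpoint 96. -/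
theorem eleven_fourths_le_log_nineteen : (11 / 4 : ℝ) ≤ Real.log (19 : ℕ) := by
  have h := natCast_le_log_of_pow_le (s := 11) (a := 19 ^ 4) (by norm_num)
  rw [Nat.cast_pow, Real.log_pow] at h
  push_cast at h ⊢
  linarith

theorem nthPrime_lt_of_le_primeCounting' {n x : ℕ} (hn : 0 < n)
    (h : n ≤ Nat.primeCounting' x) : nthPrime n < x :=
  Nat.nth_lt_of_lt_count (by change n - 1 < Nat.primeCounting' x; omega)

/-- By monotonicity, one numerical check at the left end `a` settles every `n` from `a` up to the
count at `x`. -/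
theorem nthPrime_lt_of_mem_range {n a x : ℕ} {s : ℝ} (ha : 0 < a) (han : a ≤ n)
    (hn : n ≤ Nat.primeCounting' x) (hs : s ≤ Real.log a) (hx : (x : ℝ) ≤ 2 * a * s) :
    (nthPrime n : ℝ) < 2 * n * Real.log n := by
  have h1 : (nthPrime n : ℝ) < x := by
    exact_mod_cast nthPrime_lt_of_le_primeCounting' (by omega) hn
  have ha' : (1 : ℝ) ≤ a := by exact_mod_cast ha
  have han' : (a : ℝ) ≤ n := by exact_mod_cast han
  have h2 : Real.log a ≤ Real.log n := Real.log_le_log (by linarith) han'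
  have h3 : 0 ≤ Real.log a := Real.log_nonneg ha'
  calc (nthPrime n : ℝ) < x := h1
    _ ≤ 2 * a * s := hx
    _ ≤ 2 * a * Real.log a := by gcongr
    _ ≤ 2 * n * Real.log n := by gcongr

theorem nthPrime_lt_of_lt_1024 {n : ℕ} (h9 : 9 ≤ n) (hn : n < 1024) :
    (nthPrime n : ℝ) < 2 * n * Real.log n := by
  have c32 : 11 ≤ Nat.primeCounting' 32 := by decide +kernel
  have small := fun {c k : ℕ} => add_le_primeCounting'_of_le_coprimeCount (c := c) (k := k)
    prime_dvd_210
  have large := fun {c k : ℕ} => add_le_primeCounting'_of_le_coprimeCount (c := c) (k := k)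
    prime_dvd_primorialEightyNine
  have c48 := small (k := 4) 4 32 (by norm_num) (by norm_num) c32 (by decide +kernel)
  have c64 := small (k := 3) 4 48 (by norm_num) (by norm_num) c48 (by decide +kernel)
  have c96 := small (k := 6) 5 64 (by norm_num) (by norm_num) c64 (by decide +kernel)
  have c128 := large (k := 7) 5 96 (by norm_num) (by norm_num) c96 (by decide +kernel)
  have c192 := large (k := 12) 6 128 (by norm_num) (by norm_num) c128 (by decide +kernel)
  have c256 := large (k := 11) 6 192 (by norm_num) (by norm_num) c192 (by decide +kernel)
  have c384 := large (k := 22) 7 256 (by norm_num) (by norm_num) c256 (by decide +kernel)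
  have c512 := large (k := 21) 7 384 (by norm_num) (by norm_num) c384 (by decide +kernel)
  have c768 := large (k := 38) 8 512 (by norm_num) (by norm_num) c512 (by decide +kernel)
  have c1024 := large (k := 37) 8 768 (by norm_num) (by norm_num) c768 (by decide +kernel)
  have c1536 := large (k := 70) 9 1024 (by norm_num) (by norm_num) c1024 (by decide +kernel)
  have c2048 := large (k := 67) 9 1536 (by norm_num) (by norm_num) c1536 (by decide +kernel)
  have c3072 := large (k := 130) 10 2048 (by norm_num) (by norm_num) c2048 (by decide +kernel)
  have c4096 := large (k := 125) 10 3072 (by norm_num) (by norm_num) c3072 (by decide +kernel)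
  have c6144 := large (k := 237) 11 4096 (by norm_num) (by norm_num) c4096 (by decide +kernel)
  have c8192 := large (k := 227) 11 6144 (by norm_num) (by norm_num) c6144 (by decide +kernel)
  norm_num only at c48 c64 c96 c128 c192 c256 c384 c512 c768 c1024 c1536 c2048 c3072
  norm_num only at c4096 c6144 c8192
  rcases le_or_gt n 11 with h | h32
  · exact nthPrime_lt_of_mem_range (a := 9) (by norm_num) (by omega) (h.trans c32)
      (natCast_le_log_of_pow_le (s := 2) (by norm_num)) (by norm_num)
  rcases le_or_gt n 15 with h | h48
  · exact nthPrime_lt_of_mem_range (a := 12) (by norm_num) (by omega) (h.trans c48)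
      (natCast_le_log_of_pow_le (s := 2) (by norm_num)) (by norm_num)
  rcases le_or_gt n 18 with h | h64
  · exact nthPrime_lt_of_mem_range (a := 16) (by norm_num) (by omega) (h.trans c64)
      (natCast_le_log_of_pow_le (s := 2) (by norm_num)) (by norm_num)
  rcases le_or_gt n 24 with h | h96
  · exact nthPrime_lt_of_mem_range (a := 19) (by norm_num) (by omega) (h.trans c96)
      eleven_fourths_le_log_nineteen (by norm_num)
  rcases le_or_gt n 31 with h | h128
  · exact nthPrime_lt_of_mem_range (a := 25) (by norm_num) (by omega) (h.trans c128)
      (natCast_le_log_of_pow_le (s := 3) (by norm_num)) (by norm_num)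
  rcases le_or_gt n 43 with h | h192
  · exact nthPrime_lt_of_mem_range (a := 32) (by norm_num) (by omega) (h.trans c192)
      (natCast_le_log_of_pow_le (s := 3) (by norm_num)) (by norm_num)
  rcases le_or_gt n 54 with h | h256
  · exact nthPrime_lt_of_mem_range (a := 44) (by norm_num) (by omega) (h.trans c256)
      (natCast_le_log_of_pow_le (s := 3) (by norm_num)) (by norm_num)
  rcases le_or_gt n 76 with h | h384
  · exact nthPrime_lt_of_mem_range (a := 55) (by norm_num) (by omega) (h.trans c384)
      (natCast_le_log_of_pow_le (s := 4) (by norm_num)) (by norm_num)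
  rcases le_or_gt n 97 with h | h512
  · exact nthPrime_lt_of_mem_range (a := 77) (by norm_num) (by omega) (h.trans c512)
      (natCast_le_log_of_pow_le (s := 4) (by norm_num)) (by norm_num)
  rcases le_or_gt n 135 with h | h768
  · exact nthPrime_lt_of_mem_range (a := 98) (by norm_num) (by omega) (h.trans c768)
      (natCast_le_log_of_pow_le (s := 4) (by norm_num)) (by norm_num)
  rcases le_or_gt n 172 with h | h1024
  · exact nthPrime_lt_of_mem_range (a := 136) (by norm_num) (by omega) (h.trans c1024)
      (natCast_le_log_of_pow_le (s := 4) (by norm_num)) (by norm_num)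
  rcases le_or_gt n 242 with h | h1536
  · exact nthPrime_lt_of_mem_range (a := 173) (by norm_num) (by omega) (h.trans c1536)
      (natCast_le_log_of_pow_le (s := 5) (by norm_num)) (by norm_num)
  rcases le_or_gt n 309 with h | h2048
  · exact nthPrime_lt_of_mem_range (a := 243) (by norm_num) (by omega) (h.trans c2048)
      (natCast_le_log_of_pow_le (s := 5) (by norm_num)) (by norm_num)
  rcases le_or_gt n 439 with h | h3072
  · exact nthPrime_lt_of_mem_range (a := 310) (by norm_num) (by omega) (h.trans c3072)
      (natCast_le_log_of_pow_le (s := 5) (by norm_num)) (by norm_num)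
  rcases le_or_gt n 564 with h | h4096
  · exact nthPrime_lt_of_mem_range (a := 440) (by norm_num) (by omega) (h.trans c4096)
      (natCast_le_log_of_pow_le (s := 5) (by norm_num)) (by norm_num)
  rcases le_or_gt n 801 with h | h6144
  · exact nthPrime_lt_of_mem_range (a := 565) (by norm_num) (by omega) (h.trans c6144)
      (natCast_le_log_of_pow_le (s := 6) (by norm_num)) (by norm_num)
  exact nthPrime_lt_of_mem_range (a := 802) (by norm_num) (by omega) (le_trans (by omega) c8192)
      (natCast_le_log_of_pow_le (s := 6) (by norm_num)) (by norm_num)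

theorem nthPrime_lt_of_1024_le {n : ℕ} (hn : 1024 ≤ n) :
    (nthPrime n : ℝ) < 2 * n * Real.log n := by
  have hn' : (1024 : ℝ) ≤ n := by exact_mod_cast hn
  have hlo := Real.log_two_gt_d9
  have hhi := Real.log_two_lt_d9
  have h1024 : Real.log 1024 = 10 * Real.log 2 := by
    rw [show (1024 : ℝ) = 2 ^ 10 by norm_num, Real.log_pow]; norm_num
  have h16 : Real.log 16 = 4 * Real.log 2 := by
    rw [show (16 : ℝ) = 2 ^ 4 by norm_num, Real.log_pow]; norm_num
  set L := Real.log n with hLdef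
  have hL : 10 * Real.log 2 ≤ L := h1024 ▸ Real.log_le_log (by norm_num) hn'
  have hLn : L ≤ 10 * Real.log 2 + (n / 1024 - 1) := by
    have h := Real.log_le_sub_one_of_pos (x := (n : ℝ) / 1024) (by positivity)
    rw [Real.log_div (by positivity) (by norm_num), h1024] at h
    linarith
  have hL0 : 0 < L := by linarith
  have hll : Real.log (2 * L) ≤ 4 * Real.log 2 + (L / 8 - 1) := by
    have h := Real.log_le_sub_one_of_pos (x := 2 * L / 16) (by positivity)
    rw [Real.log_div (by positivity) (by norm_num), h16] at h
    linarith
  set X := 2 * n * L with hX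
  have hX2 : 2 ≤ X := by nlinarith
  have hlogX : Real.log X = L + Real.log (2 * L) := by
    rw [hX, show 2 * (n : ℝ) * L = n * (2 * L) by ring,
      Real.log_mul (by positivity) (by positivity)]
  have hlogX2 : Real.log (X + 2) ≤ Real.log 2 + Real.log X := by
    rw [← Real.log_mul (by norm_num) (by positivity)]
    exact Real.log_le_log (by positivity) (by linarith)
  -- The tangent bound `hll` leaves slope 2 log 2 - 9/8 > 0 in L, so the worst case is L = 10 log 2,
  -- about 0.038.
  have hgap : (0.037 : ℝ) ≤ 2 * L * Real.log 2 - L - Real.log (2 * L) := by nlinarith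
  have hpi := (Chebyshev.psi_ge' (x := X) (by positivity)).trans
    (Chebyshev.psi_le_primeCounting_mul_log' X)
  -- The gain 0.037n beats the error log(X + 2), by `hLn`.
  have hlt : (n : ℝ) * Real.log X < Nat.primeCounting ⌊X⌋₊ * Real.log X := by
    refine lt_of_lt_of_le ?_ hpi
    have h := mul_le_mul_of_nonneg_left hgap (show (0 : ℝ) ≤ n by positivity)
    rw [hlogX] at hlogX2 ⊢
    rw [hX] at hlogX2 ⊢
    linarith
  have hlogX0 : 0 < Real.log X := Real.log_pos (by linarith)
  have hcount : n < Nat.primeCounting ⌊X⌋₊ := by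
    exact_mod_cast lt_of_mul_lt_mul_right hlt hlogX0.le
  -- Zero-based, this is p_{n+1} ≤ ⌊X⌋; the spare prime makes the bound strict.
  have h1 : Nat.nth Nat.Prime n < ⌊X⌋₊ + 1 := Nat.nth_lt_of_lt_count hcount
  have h2 : nthPrime n < Nat.nth Nat.Prime n :=
    Nat.nth_strictMono Nat.infinite_setOfPred_prime (by omega)
  calc (nthPrime n : ℝ) < (⌊X⌋₊ : ℕ) := by exact_mod_cast (by omega : nthPrime n < ⌊X⌋₊)
    _ ≤ X := Nat.floor_le (by positivity)

theorem nthPrime_lt {n : ℕ} (hn : 9 ≤ n) : (nthPrime n : ℝ) < 2 * n * Real.log n :=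
  (lt_or_ge n 1024).elim (nthPrime_lt_of_lt_1024 hn) nthPrime_lt_of_1024_le

/-! ### Iterating the bound -/

theorem le_nthPrime (n : ℕ) : n ≤ nthPrime n := by
  have := Nat.add_two_le_nth_prime (n - 1)
  rw [nthPrime]
  omega

theorem le_iterPrime (n k : ℕ) : n ≤ iterPrime n k := by
  induction k with
  | zero => rfl
  | succ k ih => exact ih.trans (le_nthPrime _)

/-- Tangent line of log at 9, with log 3 ≤ 1.1. -/
theorem four_mul_log_le {x : ℝ} (hx : 9 ≤ x) : 4 * Real.log x ≤ x := by
  have h3 : Real.log 3 ≤ 1.1 := by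
    rw [Real.log_le_iff_le_exp (by norm_num)]
    have h : (3 : ℝ) ^ 10 ≤ Real.exp 1.1 ^ 10 := by
      rw [← Real.exp_nat_mul, show ((10 : ℕ) : ℝ) * 1.1 = ((11 : ℕ) : ℝ) by norm_num,
        ← Real.exp_one_pow]
      exact le_trans (by norm_num) (pow_le_pow_left₀ (by norm_num) Real.exp_one_gt_d9.le 11)
    exact le_of_pow_le_pow_left₀ (by norm_num) (Real.exp_pos _).le h
  have h := Real.log_le_sub_one_of_pos (x := x / 9) (by positivity)
  rw [Real.log_div (by positivity) (by norm_num), show (9 : ℝ) = 3 ^ 2 by norm_num,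
    Real.log_pow] at h
  push_cast at h
  linarith

theorem bound_le_pow {n k M : ℕ} (hM : 9 ≤ M) (hn : n ≤ M) (hk : k + 1 ≤ M) :
    (2 : ℝ) ^ (2 * k + 1) * n * k.factorial * Real.log M ^ (k + 1) ≤ (M : ℝ) ^ (2 * (k + 1)) := by
  have hM' : (9 : ℝ) ≤ M := by exact_mod_cast hM
  have hn' : (n : ℝ) ≤ M := by exact_mod_cast hn
  have hlog : 0 ≤ Real.log M := Real.log_nonneg (by linarith)
  have hfac : (k.factorial : ℝ) ≤ (M : ℝ) ^ k := by
    exact_mod_cast (Nat.factorial_le_pow k).trans (Nat.pow_le_pow_left (by omega) k)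
  calc (2 : ℝ) ^ (2 * k + 1) * n * k.factorial * Real.log M ^ (k + 1)
      ≤ 2 ^ (2 * k + 2) * M * (M : ℝ) ^ k * Real.log M ^ (k + 1) := by
        gcongr <;> norm_num
    _ = (M : ℝ) ^ (k + 1) * (4 * Real.log M) ^ (k + 1) := by
        rw [mul_pow, show (4 : ℝ) = 2 ^ 2 by norm_num, ← pow_mul]
        ring
    _ ≤ (M : ℝ) ^ (k + 1) * (M : ℝ) ^ (k + 1) := by
        gcongr
        exact four_mul_log_le hM'
    _ = (M : ℝ) ^ (2 * (k + 1)) := by ring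

theorem iterPrime_succ_lt {n : ℕ} (hn : 9 ≤ n) (k : ℕ) :
    (iterPrime n (k + 1) : ℝ) <
      2 ^ (2 * k + 1) * n * k.factorial * Real.log (max (k + 1) n : ℕ) ^ (k + 1) := by
  induction k with
  | zero =>
    rw [iterPrime_one, max_eq_right (by omega)]
    simpa using nthPrime_lt hn
  | succ k ih =>
    set m := iterPrime n (k + 1)
    set M := max (k + 1) n with hMdef
    have hM : 9 ≤ M := hn.trans (le_max_right _ _)
    have hM' : (9 : ℝ) ≤ M := by exact_mod_cast hM
    have hlog : 0 < Real.log M := Real.log_pos (by linarith)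
    have hm : 9 ≤ m := hn.trans (le_iterPrime n (k + 1))
    have hm' : (9 : ℝ) ≤ m := by exact_mod_cast hm
    have hlogm : Real.log m ≤ 2 * (k + 1) * Real.log M := by
      have h := Real.log_le_log (by linarith)
        (ih.le.trans (bound_le_pow hM (le_max_right _ _) (le_max_left _ _)))
      rw [Real.log_pow] at h
      push_cast at h
      exact h
    have hMM : Real.log M ≤ Real.log (max (k + 1 + 1) n : ℕ) :=
      Real.log_le_log (by linarith) (by exact_mod_cast max_le_max_right n (by omega))
    calc (iterPrime n (k + 1 + 1) : ℝ) < 2 * m * Real.log m := nthPrime_lt hm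
      _ ≤ 2 * m * (2 * (k + 1) * Real.log M) := by gcongr
      _ ≤ 2 * (2 ^ (2 * k + 1) * n * k.factorial * Real.log M ^ (k + 1)) *
          (2 * (k + 1) * Real.log M) := by gcongr
      _ = 2 ^ (2 * (k + 1) + 1) * n * (k + 1).factorial * Real.log M ^ (k + 1 + 1) := by
        rw [Nat.factorial_succ]
        push_cast
        ring
      _ ≤ _ := by gcongr

theorem mainTheorem6 (n : ℕ) (hn : 9 ≤ n) (k : ℕ) (hk : 1 ≤ k) :
    (iterPrime n k : ℝ) <
        2 ^ (2 * k - 1) * (n : ℝ) * (Nat.factorial (k - 1) : ℝ) *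
          Real.log ((max k n : ℕ) : ℝ) ^ k ∧
      (n ≤ k → (iterPrime n k : ℝ) < (4 * (k : ℝ) * Real.log (k : ℝ)) ^ k) := by
  obtain ⟨k, rfl⟩ : ∃ j, k = j + 1 := ⟨k - 1, by omega⟩
  have h := iterPrime_succ_lt hn k
  refine ⟨h, fun hnk => h.trans_le ?_⟩
  rw [max_eq_left hnk]
  have hlog : 0 ≤ Real.log (k + 1 : ℕ) := Real.log_natCast_nonneg _
  have hfac : (n : ℝ) * k.factorial ≤ ((k + 1 : ℕ) : ℝ) ^ (k + 1) := by
    calc (n : ℝ) * k.factorial ≤ ((k + 1 : ℕ) : ℝ) * k.factorial := by gcongr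
      _ = ((k + 1).factorial : ℝ) := by rw [Nat.factorial_succ]; push_cast; ring
      _ ≤ _ := by exact_mod_cast Nat.factorial_le_pow (k + 1)
  calc (2 : ℝ) ^ (2 * k + 1) * n * k.factorial * Real.log (k + 1 : ℕ) ^ (k + 1)
      = 2 ^ (2 * k + 1) * (n * k.factorial) * Real.log (k + 1 : ℕ) ^ (k + 1) := by ring
    _ ≤ 2 ^ (2 * k + 2) * ((k + 1 : ℕ) : ℝ) ^ (k + 1) * Real.log (k + 1 : ℕ) ^ (k + 1) := by
        gcongr <;> norm_num
    _ = _ := by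
        rw [mul_pow, mul_pow, show (4 : ℝ) = 2 ^ 2 by norm_num, ← pow_mul]
        ring
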